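/- For a finite simple graph $G$ on $N$ vertices, one qubit per vertex, let $|\psi_G\rangle$ be the graph state (prepare every qubit in $|+\rangle=(|0\rangle+|1\rangle)/\sqrt2$ and apply a controlled-phase gate along every edge), and for real $x\ge -1$ let $$\rho_G(x)=\frac{\mathbb 1+x\,|\psi_G\rangle\langle\psi_G|}{2^N+x}$$ be the maximally (globally) depolarized graph state. SLOCC means finitely many rounds of local measurements (with ancillas) by the parties, all outcomes being communicated, with postselection. We say that $\rho_G(x)$ can be purified if, every qubit being held by a different party (who holds that qubit of all copies), for every $\varepsilon>0$ there is an SLOCC protocol that from finitely many copies of $\rho_G(x)$ produces, with nonzero probability, a state whose fidelity with $|\psi_G\rangle$ is at least $1-\varepsilon$. (1) Let $G$ arise from a nonempty graph $H$ by adding one vertex $w$ (so that $H$ is the subgraph induced on the other vertices), and let the qubits of $G$ be distributed among parties in such a way that all neighbours of $w$ are held by the party that holds $w$. Then $\rho_G(x)$ can be obtained exactly, with certainty, by local operations and classical communication from one copy of $\rho_H(x)$, with the same $x\ge-1$. In particular $\rho_N(x)$ is built locally from $\rho_{N-1}(x)$ for linear clusters (paths; the new end is held by the holder of the previous end) and for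 GHZ states (stars; the new leaf is held by the holder of the centre), for all $N\ge 2$. (2) Let $G$ be any graph and $v$ a vertex of $G$ that is not isolated. If one party holds the qubit $v$ and a second party holds all the other qubits, then $\rho_G(x)$ can be obtained exactly, with certainty, by local operations and classical communication from one copy of the two-qubit state $\rho_{K_2}(x)$, with the same $x\ge-1$. (3) Let $G$ be any graph on $N$ vertices with at least one edge (for example any connected graph with $N\ge2$) and let $x\ge -1$. The fidelity of $\rho_G(x)$ is $\langle\psi_G|\rho_G(x)|\psi_G\rangle=\frac{1+x}{2^N+x}$; it is at most $\frac{3}{2^N+2}$ if and only if $x\le 2$; and in that case $\rho_G(x)$ cannot be purified. -/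

import Mathlib

open scoped Matrix

noncomputable section

/-- Operators on the joint space of finitely many parties, party `p` holding a local space with
orthonormal basis `d p`. -/
abbrev Op {P : Type} (d : P → Type) : Type :=
  Matrix (∀ p, d p) (∀ p, d p) ℂ

/-- The product operator `⨂ p, A p`, where `A p` maps the local space of party `p` with basis `d p`
to one with basis `e p`. -/
def localOp {P : Type} [Fintype P] {d e : P → Type} (A : ∀ p, Matrix (e p) (d p) ℂ) :
    Matrix (∀ p, e p) (∀ p, d p) ℂ :=
  Matrix.of fun a b => ∏ p, A p (a p) (b p)

/-- Stochastic local operations and classical communication, with finitely many rounds.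
`IsSLOCC Φ` says that `Φ` is the unnormalised state transformation of an SLOCC protocol: the trace
of `Φ ρ` is the probability that the protocol succeeds on `ρ`.

A protocol may stop and report failure (`fail`), stop and report success (`done`), or perform a
round (`step`). In a round every party `p` performs a local measurement with outcomes `O p`, given
by Kraus operators `K p o` (possibly changing the local space, so that ancillas may be added or
discarded); a party that idles has a single outcome with Kraus operator `1`. All outcomes are
announced to everybody, and the rest `Φ o` of the protocol depends on them. -/
inductive IsSLOCC {P : Type} [Fintype P] [DecidableEq P] :
    ∀ {d f : P → Type} [∀ p, Fintype (d p)] [∀ p, DecidableEq (d p)]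
      [∀ p, Fintype (f p)] [∀ p, DecidableEq (f p)], (Op d → Op f) → Prop
  | fail {d f : P → Type} [∀ p, Fintype (d p)] [∀ p, DecidableEq (d p)]
      [∀ p, Fintype (f p)] [∀ p, DecidableEq (f p)] :
      IsSLOCC (fun _ : Op d => (0 : Op f))
  | done {d : P → Type} [∀ p, Fintype (d p)] [∀ p, DecidableEq (d p)] :
      IsSLOCC (fun ρ : Op d => ρ)
  | step {d e f : P → Type} [∀ p, Fintype (d p)] [∀ p, DecidableEq (d p)]
      [∀ p, Fintype (e p)] [∀ p, DecidableEq (e p)]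
      [∀ p, Fintype (f p)] [∀ p, DecidableEq (f p)]
      (O : P → Type) [∀ p, Fintype (O p)]
      (K : ∀ p, O p → Matrix (e p) (d p) ℂ)
      (hK : ∀ p, ∑ o, (K p o)ᴴ * K p o = 1)
      (Φ : (∀ p, O p) → Op e → Op f)
      (hΦ : ∀ o, IsSLOCC (Φ o)) :
      IsSLOCC (fun ρ : Op d =>
        ∑ o : ∀ p, O p,
          Φ o (localOp (fun p => K p (o p)) * ρ * (localOp (fun p => K p (o p)))ᴴ))

/-- `n` copies of the state `ρ`, each party holding its part of every copy. -/
def copies {P : Type} {d : P → Type} (n : ℕ) (ρ : Op d) : Op (fun p => Fin n → d p) :=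
  Matrix.of fun a b => ∏ k, ρ (fun p => a p k) (fun p => b p k)

/-- The overlap `⟨ψ|ρ|ψ⟩`, a real number for Hermitian `ρ`; for a normalised state `ρ` and a unit
vector `ψ` it is the fidelity. -/
def fidelity {ι : Type} [Fintype ι] (ψ : ι → ℂ) (ρ : Matrix ι ι ℂ) : ℝ :=
  (star ψ ⬝ᵥ (ρ *ᵥ ψ)).re

/-- `ρ` can be purified to `ψ`: for every `ε > 0` there is an SLOCC protocol which, from finitely
many copies of `ρ`, produces with nonzero probability a state whose (normalised) fidelity with `ψ`
is at least `1 - ε`. -/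
def Purifiable {P : Type} [Fintype P] [DecidableEq P] {d : P → Type}
    [∀ p, Fintype (d p)] [∀ p, DecidableEq (d p)] (ρ : Op d) (ψ : (∀ p, d p) → ℂ) : Prop :=
  ∀ ε : ℝ, 0 < ε → ∃ (n : ℕ) (Φ : Op (fun p => Fin n → d p) → Op d),
    IsSLOCC Φ ∧ 0 < (Φ (copies n ρ)).trace.re ∧
      1 - ε ≤ fidelity ψ (Φ (copies n ρ)) / (Φ (copies n ρ)).trace.re

open Classical in
/-- The graph state: every qubit is prepared in `|+⟩` and a controlled-phase gate is applied along
every edge, which multiplies the amplitude of `|a⟩` by `-1` if both ends of the edge carry a `1`. -/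
def graphState {V : Type} [Fintype V] (G : SimpleGraph V) (a : V → Fin 2) : ℂ :=
  (((√2 : ℝ) : ℂ)⁻¹) ^ Fintype.card V *
    ∏ e ∈ G.edgeFinset, if ∀ v ∈ e, a v = 1 then -1 else 1

/-- The globally depolarised graph state `(𝟙 + x |ψ_G⟩⟨ψ_G|) / (2 ^ N + x)`, an operator of the
parties `V` who hold one qubit each. -/
def noisyState {V : Type} [Fintype V] [DecidableEq V] (G : SimpleGraph V) (x : ℝ) :
    Op (fun _ : V => Fin 2) :=
  ((2 : ℂ) ^ Fintype.card V + (x : ℂ))⁻¹ •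
    (1 + (x : ℂ) • Matrix.vecMulVec (graphState G) (star (graphState G)))

/-- The same operator on the qubits `V`, when they are handed out to parties `P` and qubit `v` is
held by the party `h v`. -/
def distribute {V P : Type} (h : V → P) (ρ : Op (fun _ : V => Fin 2)) :
    Op (fun p : P => {v // h v = p} → Fin 2) :=
  ρ.submatrix (fun a v => a (h v) ⟨v, rfl⟩) (fun a v => a (h v) ⟨v, rfl⟩)

/-- For qubits `V` held according to `h` and qubits `W` held according to `k` by the same parties:
the state `ρ` can be converted into the state `σ` by SLOCC, from one copy and exactly, with
`Φ ρ = σ` unnormalised, hence with success probability one if both have trace one. -/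
def LocallyConvertible {P V W : Type} [Fintype P] [DecidableEq P] [Fintype V] [DecidableEq V]
    [Fintype W] [DecidableEq W] (h : V → P) (ρ : Op (fun _ : V => Fin 2))
    (k : W → P) (σ : Op (fun _ : W => Fin 2)) : Prop :=
  ∃ Φ : Op (fun p : P => {v // h v = p} → Fin 2) → Op (fun p : P => {w // k w = p} → Fin 2),
    IsSLOCC Φ ∧ Φ (distribute h ρ) = distribute k σ

end

/-! Conversions: let a local isometry `A` take `ψ` to `φ`, from total dimension `D` to `E`, with all
factors but one unitary. Applied to the noisy state it gives `A Aᴴ + x|φ⟩⟨φ|` up to the factor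
`1/(D+x)`, so only `1 - A Aᴴ` is missing from the noise. With one non-unitary factor this complement
is a product of local projections, hence locally preparable; mixing it in with probability
`(E-D)/(E+x)` restores white noise with the same `x` (`exists_isSLOCC_depolarized`). Attaching a
vertex is such an isometry (`attachOp`). So is the passage from `K₂` to any graph cut at a
non-isolated `v`, because the qubit `v` is maximally mixed (`splitOp`).

Impossibility: for the same reason, twice the partial transpose at `v` of `|ψ_G⟩⟨ψ_G|` is an
isometrically embedded swap, with eigenvalues in `{-1, 0, 1}`. Hence the noisy state has positive
partial transpose for `-1 ≤ x ≤ 2`. Copies and SLOCC preserve this positivity, and it bounds the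
overlap with `ψ_G` by half the trace, so fidelities near 1 are out of reach. -/

open scoped Matrix

noncomputable section

/-! ### Algebra of product operators. -/

section LocalOperators

variable {P : Type} [Fintype P] {d e f : P → Type}

theorem localOp_apply (A : ∀ p, Matrix (e p) (d p) ℂ) (a : ∀ p, e p) (b : ∀ p, d p) :
    localOp A a b = ∏ p, A p (a p) (b p) := rfl

theorem localOp_mul [DecidableEq P] [∀ p, Fintype (e p)] (A : ∀ p, Matrix (f p) (e p) ℂ)
    (B : ∀ p, Matrix (e p) (d p) ℂ) :
    localOp A * localOp B = localOp fun p => A p * B p := by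
  ext a c
  simp only [Matrix.mul_apply, localOp_apply, ← Finset.prod_mul_distrib]
  exact (Fintype.prod_sum fun p j => A p (a p) j * B p j (c p)).symm

theorem localOp_conjTranspose (A : ∀ p, Matrix (e p) (d p) ℂ) :
    (localOp A)ᴴ = localOp fun p => (A p)ᴴ := by
  ext a b
  simp [Matrix.conjTranspose_apply, localOp_apply]

theorem localOp_one [∀ p, DecidableEq (d p)] :
    localOp (fun p => (1 : Matrix (d p) (d p) ℂ)) = 1 := by
  classical
  ext a b
  simp only [localOp_apply, Matrix.one_apply]
  rw [Finset.prod_ite_zero]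
  simp [funext_iff]

theorem localOp_smul (c : P → ℂ) (A : ∀ p, Matrix (e p) (d p) ℂ) :
    localOp (fun p => c p • A p) = (∏ p, c p) • localOp A := by
  ext a b
  simp [localOp_apply, Finset.prod_mul_distrib]

theorem localOp_single [∀ p, DecidableEq (d p)] [∀ p, DecidableEq (e p)]
    (a : ∀ p, e p) (b : ∀ p, d p) :
    localOp (fun p => Matrix.single (a p) (b p) (1 : ℂ)) = Matrix.single a b 1 := by
  classical
  ext i j
  simp only [localOp_apply, Matrix.single_apply]
  rw [Finset.prod_ite_zero]
  simp [funext_iff, forall_and]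

theorem trace_localOp [DecidableEq P] [∀ p, Fintype (d p)] (A : ∀ p, Matrix (d p) (d p) ℂ) :
    (localOp A).trace = ∏ p, (A p).trace := by
  simp only [Matrix.trace, Matrix.diag, localOp_apply]
  exact (Fintype.prod_sum fun p j => A p j j).symm

/-- The complement of a product projection is in general not a product; it is one when a single
factor is nontrivial. This is what makes the missing noise locally preparable. -/
theorem localOp_ite_one_sub [DecidableEq P] [∀ p, DecidableEq (d p)] (p₀ : P)
    (Q : ∀ p, Matrix (d p) (d p) ℂ) (hQ : ∀ p, p ≠ p₀ → Q p = 1) :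
    localOp (fun p => if p = p₀ then 1 - Q p else 1) = 1 - localOp Q := by
  rw [← localOp_one]
  ext a b
  simp only [localOp_apply, Matrix.sub_apply]
  rw [← Finset.mul_prod_erase _ _ (Finset.mem_univ p₀),
    ← Finset.mul_prod_erase _ (fun p => (1 : Matrix (d p) (d p) ℂ) (a p) (b p))
      (Finset.mem_univ p₀),
    ← Finset.mul_prod_erase _ (fun p => Q p (a p) (b p)) (Finset.mem_univ p₀)]
  rw [Finset.prod_congr rfl (g := fun p => (1 : Matrix (d p) (d p) ℂ) (a p) (b p)),
    Finset.prod_congr (s₁ := Finset.univ.erase p₀) rfl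
      (f := fun p => Q p (a p) (b p)) (g := fun p => (1 : Matrix (d p) (d p) ℂ) (a p) (b p))]
  · simp [sub_mul]
  · intro p hp
    rw [hQ p (Finset.ne_of_mem_erase hp)]
  · intro p hp
    rw [if_neg (Finset.ne_of_mem_erase hp)]

end LocalOperators

/-! ### Elementary protocols and the conversion of depolarised states. -/

section Protocols

open scoped ComplexOrder

variable {P : Type} [Fintype P] [DecidableEq P] {d e : P → Type}
  [∀ p, Fintype (d p)] [∀ p, DecidableEq (d p)] [∀ p, Fintype (e p)] [∀ p, DecidableEq (e p)]

/-- Homogeneity lets the probability of a branch be pulled out of the rest of the protocol. -/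
theorem IsSLOCC.map_smul {Φ : Op d → Op e} (h : IsSLOCC Φ) (c : ℂ) (ρ : Op d) :
    Φ (c • ρ) = c • Φ ρ := by
  induction h with
  | fail => simp
  | done => rfl
  | step O K hK Φ hΦ ih =>
    simp only [Finset.smul_sum, ← ih]
    simp

theorem IsSLOCC.of_isometry (A : ∀ p, Matrix (e p) (d p) ℂ) (hA : ∀ p, (A p)ᴴ * A p = 1) :
    IsSLOCC fun ρ : Op d => localOp A * ρ * (localOp A)ᴴ := by
  have h := IsSLOCC.step (fun _ : P => Unit) (fun p _ => A p) (by simpa using hA)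
    (fun _ (ρ : Op e) => ρ) (fun _ => IsSLOCC.done)
  simpa using h

/-- A random choice between two protocols, made by one of the parties. -/
theorem IsSLOCC.mix (p₀ : P) {Φ Ψ : Op d → Op e} (hΦ : IsSLOCC Φ) (hΨ : IsSLOCC Ψ)
    {s t : ℝ} (hs : 0 ≤ s) (ht : 0 ≤ t) (hst : s + t = 1) :
    IsSLOCC fun ρ : Op d => (s : ℂ) • Φ ρ + (t : ℂ) • Ψ ρ := by
  -- Only `p₀` tosses a coin; for every other party the outcome `false` has Kraus operator `0`.
  let g : P → Bool → ℝ := fun p b =>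
    if p = p₀ then (if b then √s else √t) else (if b then 1 else 0)
  have key : ∀ o : P → Bool, ∀ ρ : Op d,
      localOp (fun p => (g p (o p) : ℂ) • (1 : Matrix (d p) (d p) ℂ)) * ρ *
        (localOp (fun p => (g p (o p) : ℂ) • (1 : Matrix (d p) (d p) ℂ)))ᴴ =
      ((∏ p, g p (o p) ^ 2 : ℝ) : ℂ) • ρ := by
    intro o ρ
    rw [localOp_smul, localOp_one]
    rw [Finset.prod_pow, ← Complex.ofReal_prod]
    simp [smul_smul, sq]
  have h := IsSLOCC.step (d := d) (fun _ : P => Bool)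
    (fun p b => (g p b : ℂ) • (1 : Matrix (d p) (d p) ℂ))
    (by
      intro p
      by_cases hp : p = p₀
      · simp only [g, hp, if_true, Fintype.sum_bool]
        simp only [Matrix.conjTranspose_smul, Matrix.conjTranspose_one, smul_mul_smul_comm, mul_one,
          ← add_smul]
        simp [← Complex.ofReal_mul, ← Complex.ofReal_add, Real.mul_self_sqrt, hs, ht, hst]
      · simp [g, hp])
    (fun o => if o p₀ then Φ else Ψ) (by intro o; by_cases h : o p₀ <;> simp [h, hΦ, hΨ])
  convert h using 2 with ρ
  have hlin : ∀ (o : P → Bool) (c : ℂ), (if o p₀ then Φ else Ψ) (c • ρ) =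
      c • (if o p₀ then Φ else Ψ) ρ := by
    intro o c
    by_cases h : o p₀ <;> simp [h, hΦ.map_smul, hΨ.map_smul]
  simp only [key, hlin]
  -- Of all outcome tuples only two have nonzero weight: everybody `true`, and everybody `true`
  -- except `p₀`.
  rw [Fintype.sum_eq_add (fun _ => true) (Function.update (fun _ => true) p₀ false)]
  · have h1 : ∏ p, g p true ^ 2 = s := by
      rw [Finset.prod_eq_single p₀]
      · simp [g, Real.sq_sqrt hs]
      · intro p _ hp; simp [g, hp]
      · simp
    have h2 : ∏ p, g p (Function.update (fun _ => true) p₀ false p) ^ 2 = t := by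
      rw [Finset.prod_eq_single p₀]
      · simp [g, Real.sq_sqrt ht]
      · intro p _ hp; simp [g, hp]
      · simp
    rw [h1, h2]
    simp
  · intro h
    simpa using congrFun h p₀
  · rintro o ⟨h1, h2⟩
    have : ∃ p, p ≠ p₀ ∧ o p = false := by
      by_contra! hc
      simp only [ne_eq, Bool.not_eq_false] at hc
      cases h : o p₀
      · apply h2
        funext p
        by_cases hp : p = p₀
        · subst hp; simp [h]
        · simp [hp, hc p hp]
      · apply h1
        funext p
        by_cases hp : p = p₀
        · subst hp; simp [h]
        · simp [hc p hp]
    obtain ⟨p, hp, hop⟩ := this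
    rw [Finset.prod_eq_zero (Finset.mem_univ p)]
    · simp
    · simp [g, hp, hop]

/-- Discarding the state and preparing the normalised product of projections `R p`. -/
theorem IsSLOCC.prepare (R : ∀ p, Matrix (e p) (e p) ℂ) (hR : ∀ p, (R p)ᴴ = R p)
    (hR2 : ∀ p, R p * R p = R p) (r : P → ℝ) (hr : ∀ p, 0 < r p) (htr : ∀ p, (R p).trace = r p) :
    IsSLOCC fun ρ : Op d => (ρ.trace / ∏ p, (r p : ℂ)) • localOp R := by
  have hc : ∀ p, ((√(r p))⁻¹ : ℂ) * ((√(r p))⁻¹ : ℂ) = (r p : ℂ)⁻¹ := by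
    intro p
    rw [← mul_inv, ← Complex.ofReal_mul, Real.mul_self_sqrt (hr p).le]
  -- Outcome `(i, j)` has Kraus operator `R|i⟩⟨j|/√r`: measure `j`, then prepare `R|i⟩`.
  -- Completeness holds because `∑ i, ⟨i|R|i⟩ = tr R = r`.
  have h := IsSLOCC.step (d := d) (e := e) (fun p => e p × d p)
    (fun p o => ((√(r p))⁻¹ : ℂ) • (R p * Matrix.single o.1 o.2 (1 : ℂ)))
    (by
      intro p
      have : ∀ o : e p × d p, (((√(r p))⁻¹ : ℂ) • (R p * Matrix.single o.1 o.2 (1 : ℂ)))ᴴ *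
          (((√(r p))⁻¹ : ℂ) • (R p * Matrix.single o.1 o.2 (1 : ℂ))) =
          ((r p : ℂ)⁻¹ * R p o.1 o.1) • Matrix.single o.2 o.2 (1 : ℂ) := by
        intro o
        rw [Matrix.conjTranspose_smul, Matrix.smul_mul, Matrix.mul_smul, smul_smul,
          Matrix.conjTranspose_mul, hR,
          Matrix.mul_assoc, ← Matrix.mul_assoc (R p), hR2, ← Matrix.mul_assoc]
        simp [hc, Matrix.single_mul_mul_single, Matrix.smul_single]
      simp only [this]
      rw [Fintype.sum_prod_type_right]
      simp only [← Finset.sum_smul, ← Finset.mul_sum]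
      have h2 : ∑ i, R p i i = r p := htr p
      rw [h2, inv_mul_cancel₀ (by exact_mod_cast (hr p).ne')]
      ext i j
      simp [Matrix.sum_apply, Matrix.single_apply, Matrix.one_apply, ite_and])
    (fun _ (ρ : Op e) => ρ) (fun _ => IsSLOCC.done)
  convert h using 2 with ρ
  have h1 : ∀ o : ∀ p, e p × d p,
      localOp (fun p => ((√(r p))⁻¹ : ℂ) • (R p * Matrix.single (o p).1 (o p).2 (1 : ℂ))) =
      (∏ p, ((√(r p))⁻¹ : ℂ)) •
        (localOp R * Matrix.single (fun p => (o p).1) (fun p => (o p).2) (1 : ℂ)) := by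
    intro o
    rw [localOp_smul, ← localOp_mul, localOp_single]
  have h2 : ∀ o : ∀ p, e p × d p,
      localOp (fun p => ((√(r p))⁻¹ : ℂ) • (R p * Matrix.single (o p).1 (o p).2 (1 : ℂ))) * ρ *
      (localOp (fun p => ((√(r p))⁻¹ : ℂ) • (R p * Matrix.single (o p).1 (o p).2 (1 : ℂ))))ᴴ =
      (∏ p, (r p : ℂ))⁻¹ • (localOp R * (ρ (fun p => (o p).2) (fun p => (o p).2) •
        Matrix.single (fun p => (o p).1) (fun p => (o p).1) (1 : ℂ)) * localOp R) := by
    intro o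
    rw [h1, Matrix.conjTranspose_smul, Matrix.smul_mul, Matrix.smul_mul, Matrix.mul_smul, smul_smul,
      Matrix.conjTranspose_mul, localOp_conjTranspose]
    congr 1
    · rw [← Finset.prod_inv_distrib, ← Finset.prod_congr rfl fun p _ => hc p,
        Finset.prod_mul_distrib]
      simp
    · simp only [hR, Matrix.mul_assoc]
      congr 1
      simp only [← Matrix.mul_assoc]
      congr 1
      simp [Matrix.single_mul_mul_single, Matrix.smul_single]
  simp only [h2]
  rw [← Finset.smul_sum, ← Matrix.sum_mul, ← Matrix.mul_sum,
    ← (Equiv.arrowProdEquivProdArrow P e d).symm.sum_comp, Fintype.sum_prod_type]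
  simp only [Equiv.arrowProdEquivProdArrow, Equiv.coe_fn_symm_mk]
  have h3 : ∑ a : ∀ p, e p, ∑ b : ∀ p, d p, ρ b b • Matrix.single a a (1 : ℂ) =
      ρ.trace • (1 : Op e) := by
    simp only [← Finset.sum_smul]
    rw [← Finset.smul_sum]
    congr 1
    ext i j
    simp [Matrix.sum_apply, Matrix.single_apply, Matrix.one_apply, ite_and]
  rw [h3]
  simp only [Matrix.mul_smul, Matrix.smul_mul, mul_one, localOp_mul, hR2, smul_smul]
  rw [div_eq_inv_mul]

/-- The depolarised version of a pure state is converted, keeping the parameter `x`, into that of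
its image under local isometries all but one of which are unitary. -/
theorem exists_isSLOCC_depolarized (p₀ : P) (A : ∀ p, Matrix (e p) (d p) ℂ)
    (hA : ∀ p, (A p)ᴴ * A p = 1) (hA' : ∀ p, p ≠ p₀ → A p * (A p)ᴴ = 1)
    (ψ : (∀ p, d p) → ℂ) (φ : (∀ p, e p) → ℂ) (hφ : localOp A *ᵥ ψ = φ)
    (hψ : star ψ ⬝ᵥ ψ = 1) {x : ℝ} (hx : 0 < (Fintype.card (∀ p, d p) : ℝ) + x) :
    ∃ Φ : Op d → Op e, IsSLOCC Φ ∧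
      Φ (((Fintype.card (∀ p, d p) : ℂ) + x)⁻¹ • (1 + (x : ℂ) • Matrix.vecMulVec ψ (star ψ))) =
        ((Fintype.card (∀ p, e p) : ℂ) + x)⁻¹ • (1 + (x : ℂ) • Matrix.vecMulVec φ (star φ)) := by
  set D : ℝ := (Fintype.card (∀ p, d p) : ℝ) with hD
  set E : ℝ := (Fintype.card (∀ p, e p) : ℝ) with hE
  have hDc : (Fintype.card (∀ p, d p) : ℂ) = (D : ℂ) := by simp [hD]
  have hEc : (Fintype.card (∀ p, e p) : ℂ) = (E : ℂ) := by simp [hE]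
  rw [hDc, hEc]
  set ρ : Op d := ((D : ℂ) + x)⁻¹ • (1 + (x : ℂ) • Matrix.vecMulVec ψ (star ψ)) with hρ
  have hx0 : (D : ℂ) + x ≠ 0 := by exact_mod_cast hx.ne'
  have hρtr : ρ.trace = 1 := by
    rw [hρ, Matrix.trace_smul, Matrix.trace_add, Matrix.trace_one, Matrix.trace_smul,
      Matrix.trace_vecMulVec, dotProduct_comm, hψ, hDc]
    simp [hx0]
  set Q : ∀ p, Matrix (e p) (e p) ℂ := fun p => A p * (A p)ᴴ with hQ
  set R : ∀ p, Matrix (e p) (e p) ℂ := fun p => if p = p₀ then 1 - Q p else 1 with hRdef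
  have hQ2 : ∀ p, Q p * Q p = Q p := by
    intro p
    simp only [hQ]
    rw [Matrix.mul_assoc, ← Matrix.mul_assoc (A p)ᴴ, hA, Matrix.one_mul]
  have hQh : ∀ p, (Q p)ᴴ = Q p := by
    intro p
    simp [hQ]
  have hRh : ∀ p, (R p)ᴴ = R p := by
    intro p
    by_cases hp : p = p₀ <;> simp [hRdef, hp, hQh]
  have hR2 : ∀ p, R p * R p = R p := by
    intro p
    by_cases hp : p = p₀ <;> simp [hRdef, hp, mul_sub, sub_mul, hQ2]
  have hAR : localOp R = 1 - localOp A * (localOp A)ᴴ := by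
    rw [localOp_conjTranspose, localOp_mul]
    exact localOp_ite_one_sub p₀ Q hA'
  have htrR : (localOp R).trace = (E : ℂ) - D := by
    rw [hAR, Matrix.trace_sub, Matrix.trace_one, Matrix.trace_mul_comm, localOp_conjTranspose,
      localOp_mul]
    simp only [hA, localOp_one, Matrix.trace_one, hDc, hEc]
  have hpsd : ∀ p, (R p).PosSemidef := by
    intro p
    have := Matrix.posSemidef_conjTranspose_mul_self (R p)
    rwa [hRh, hR2] at this
  -- The factor `E - D` is kept on the left so that the case `E = D`, where there is nothing to
  -- prepare, is covered too.
  have hprep : 0 ≤ E - D ∧ ∃ Ψ : Op d → Op e, IsSLOCC Ψ ∧ ((E : ℂ) - D) • Ψ ρ = localOp R := by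
    have hnn : ∀ p, 0 ≤ (R p).trace := fun p => (hpsd p).trace_nonneg
    have hre : ∀ p, (R p).trace = ((R p).trace.re : ℂ) := fun p =>
      (Complex.eq_re_of_ofReal_le (r := 0) (by simpa using hnn p))
    have hED : E - D = ∏ p, (R p).trace.re := by
      have : ((E - D : ℝ) : ℂ) = ((∏ p, (R p).trace.re : ℝ) : ℂ) := by
        rw [Complex.ofReal_prod, ← Finset.prod_congr rfl fun p _ => hre p, ← trace_localOp, htrR]
        simp
      exact_mod_cast this
    have hnn' : ∀ p, 0 ≤ (R p).trace.re := fun p => (Complex.le_def.1 (hnn p)).1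
    refine ⟨hED ▸ Finset.prod_nonneg fun p _ => hnn' p, ?_⟩
    by_cases hpos : ∀ p, 0 < (R p).trace.re
    · refine ⟨_, IsSLOCC.prepare R hRh hR2 (fun p => (R p).trace.re) hpos hre, ?_⟩
      rw [hρtr, smul_smul, ← Complex.ofReal_prod, ← hED, ← Complex.ofReal_sub, mul_one_div_cancel,
        one_smul]
      rw [hED]
      exact_mod_cast (Finset.prod_pos fun p _ => hpos p).ne'
    -- A positive semidefinite factor of trace zero vanishes, so the complement is zero and the
    -- failing protocol serves, entering with weight zero.
    · push Not at hpos
      obtain ⟨p, hp⟩ := hpos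
      have h0 : R p = 0 := by
        rw [← (hpsd p).trace_eq_zero_iff, hre p, le_antisymm hp (hnn' p)]
        simp
      refine ⟨_, IsSLOCC.fail, ?_⟩
      ext a b
      simp [localOp_apply, Finset.prod_eq_zero (Finset.mem_univ p), h0]
  obtain ⟨hED, Ψ, hΨ, hΨρ⟩ := hprep
  have hEx : 0 < E + x := by linarith
  have hEx0 : (E : ℂ) + x ≠ 0 := by exact_mod_cast hEx.ne'
  -- The weights turn the normalisations `1/(D+x)` and `1/(E-D)` of the two branches into the common
  -- `1/(E+x)`.
  refine ⟨_, IsSLOCC.mix p₀ (IsSLOCC.of_isometry A hA) hΨ (s := (D + x) / (E + x))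
    (t := (E - D) / (E + x)) (by positivity) (by positivity) ?_, ?_⟩
  · field_simp
    ring
  · have h1 : localOp A * ρ * (localOp A)ᴴ =
        ((D : ℂ) + x)⁻¹ • (localOp A * (localOp A)ᴴ + (x : ℂ) • Matrix.vecMulVec φ (star φ)) := by
      rw [hρ, Matrix.mul_smul, Matrix.smul_mul, Matrix.mul_add, Matrix.add_mul, Matrix.mul_one,
        Matrix.mul_smul,
        Matrix.smul_mul, Matrix.mul_vecMulVec, Matrix.vecMulVec_mul, hφ,
        ← Matrix.star_mulVec, hφ]
    have h2 : (((E - D) / (E + x) : ℝ) : ℂ) • Ψ ρ = ((E : ℂ) + x)⁻¹ • localOp R := by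
      rw [← hΨρ, smul_smul]
      congr 1
      push_cast
      rw [div_eq_inv_mul]
    rw [h1, h2, hAR, smul_smul]
    have h3 : (((D + x) / (E + x) : ℝ) : ℂ) * ((D : ℂ) + x)⁻¹ = ((E : ℂ) + x)⁻¹ := by
      push_cast
      field_simp
    rw [h3, ← smul_add]
    congr 1
    abel

end Protocols

/-! ### Amplitudes of graph states and the maximally mixed qubit at a non-isolated vertex. -/

section GraphStates

variable {V W : Type} [Fintype V] [Fintype W]

open Classical in
/-- The sign of the amplitude of a basis state in the graph state. -/
def edgeSign (G : SimpleGraph V) (a : V → Fin 2) : ℂ :=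
  ∏ e ∈ G.edgeFinset, if ∀ v ∈ e, a v = 1 then -1 else 1

open Classical in
/-- The sign contributed by the edges at the vertex `w`. -/
def vertexSign (G : SimpleGraph V) (w : V) (a : V → Fin 2) : ℂ :=
  ∏ u, if G.Adj w u ∧ a w = 1 ∧ a u = 1 then -1 else 1

open Classical in
/-- The sign contributed by the edges that avoid the vertex `w`. -/
def awaySign (G : SimpleGraph V) (w : V) (a : V → Fin 2) : ℂ :=
  ∏ e ∈ G.edgeFinset with w ∉ e, if ∀ v ∈ e, a v = 1 then -1 else 1

theorem graphState_eq (G : SimpleGraph V) (a : V → Fin 2) :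
    graphState G a = (((√2 : ℝ) : ℂ)⁻¹) ^ Fintype.card V * edgeSign G a := rfl

theorem edgeSign_mul_self (G : SimpleGraph V) (a : V → Fin 2) :
    edgeSign G a * edgeSign G a = 1 := by
  rw [edgeSign, ← Finset.prod_mul_distrib]
  exact Finset.prod_eq_one fun e _ => by split_ifs <;> norm_num

theorem awaySign_mul_self (G : SimpleGraph V) (w : V) (a : V → Fin 2) :
    awaySign G w a * awaySign G w a = 1 := by
  rw [awaySign, ← Finset.prod_mul_distrib]
  exact Finset.prod_eq_one fun e _ => by split_ifs <;> norm_num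

theorem awaySign_congr (G : SimpleGraph V) (w : V) {a b : V → Fin 2} (h : ∀ u, u ≠ w → a u = b u) :
    awaySign G w a = awaySign G w b := by
  classical
  refine Finset.prod_congr rfl fun e he => ?_
  have hw : w ∉ e := (Finset.mem_filter.1 he).2
  have : (∀ u ∈ e, a u = 1) ↔ ∀ u ∈ e, b u = 1 :=
    forall₂_congr fun u hu => by
      rw [h]
      rintro rfl
      exact hw hu
  simp only [this]

theorem vertexSign_mul_self (G : SimpleGraph V) (w : V) (a : V → Fin 2) :
    vertexSign G w a * vertexSign G w a = 1 := by
  rw [vertexSign, ← Finset.prod_mul_distrib]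
  exact Finset.prod_eq_one fun e _ => by split_ifs <;> norm_num

theorem star_vertexSign (G : SimpleGraph V) (w : V) (a : V → Fin 2) :
    star (vertexSign G w a) = vertexSign G w a := by
  rw [vertexSign, star_prod]
  exact Finset.prod_congr rfl fun e _ => by split_ifs <;> simp

theorem star_graphState_apply (G : SimpleGraph V) (a : V → Fin 2) :
    star (graphState G a) = graphState G a := by
  rw [graphState_eq, edgeSign, star_mul', star_pow, star_prod]
  congr 1
  · simp
  · exact Finset.prod_congr rfl fun e _ => by split_ifs <;> simp

theorem inv_sqrt_two_mul_self : (((√2 : ℝ) : ℂ)⁻¹) * (((√2 : ℝ) : ℂ)⁻¹) = 2⁻¹ := by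
  rw [← mul_inv, ← Complex.ofReal_mul, Real.mul_self_sqrt (by norm_num)]
  norm_num

theorem graphState_mul_self (G : SimpleGraph V) (a : V → Fin 2) :
    graphState G a * graphState G a = (2⁻¹ : ℂ) ^ Fintype.card V := by
  rw [graphState_eq, mul_mul_mul_comm, edgeSign_mul_self, ← mul_pow, inv_sqrt_two_mul_self, mul_one]

theorem sum_graphState_mul_self [DecidableEq V] (G : SimpleGraph V) :
    ∑ a, graphState G a * graphState G a = 1 := by
  simp [graphState_mul_self]

theorem star_graphState_dotProduct [DecidableEq V] (G : SimpleGraph V) :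
    star (graphState G) ⬝ᵥ graphState G = 1 := by
  simp only [dotProduct, Pi.star_apply, star_graphState_apply, sum_graphState_mul_self]

theorem edgeSign_eq_mul_vertexSign (G : SimpleGraph V) (w : V) (a : V → Fin 2) :
    edgeSign G a = awaySign G w a * vertexSign G w a := by
  classical
  rw [edgeSign, awaySign, ← Finset.prod_filter_not_mul_prod_filter _ (fun e => w ∈ e)]
  congr 1
  rw [vertexSign]
  have h : ∀ u, (if G.Adj w u ∧ a w = 1 ∧ a u = 1 then (-1 : ℂ) else 1) =
      if G.Adj w u then (if ∀ v ∈ s(w, u), a v = 1 then (-1 : ℂ) else 1) else 1 := by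
    intro u
    by_cases h : G.Adj w u <;> simp [h]
  simp only [h]
  rw [← Finset.prod_filter (fun u => G.Adj w u)]
  symm
  refine Finset.prod_bij (fun u _ => s(w, u)) ?_ ?_ ?_ ?_
  · intro u hu
    simpa using hu
  · intro u _ u' _ h
    exact Sym2.congr_right.1 h
  · intro e he
    induction e with
    | _ x y =>
      simp only [Finset.mem_filter, SimpleGraph.mem_edgeFinset, SimpleGraph.mem_edgeSet,
        Sym2.mem_iff] at he
      obtain ⟨hxy, rfl | rfl⟩ := he
      · exact ⟨y, by simpa using hxy, rfl⟩
      · exact ⟨x, by simpa using hxy.symm, Sym2.eq_swap⟩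
  · intro u _
    rfl

/-- Since `f` misses exactly `w`, it matches the edges of `H` with the edges of `G` avoiding `w`. -/
theorem edgeSign_of_embedding {H : SimpleGraph V} {G : SimpleGraph W} (f : H ↪g G) (w : W)
    (hf : Set.range f = {w}ᶜ) (a : W → Fin 2) :
    edgeSign G a = edgeSign H (a ∘ f) * vertexSign G w a := by
  classical
  rw [edgeSign_eq_mul_vertexSign G w]
  congr 1
  rw [edgeSign, awaySign]
  symm
  refine Finset.prod_bij (fun e _ => e.map f) ?_ ?_ ?_ ?_
  · intro e he
    have hw : ∀ v, f v ≠ w := fun v => by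
      have : f v ∈ Set.range f := ⟨v, rfl⟩
      rwa [hf] at this
    induction e with
    | _ x y =>
      simp only [SimpleGraph.mem_edgeFinset, SimpleGraph.mem_edgeSet] at he
      simp [he, (hw x).symm, (hw y).symm]
  · intro e _ e' _ h
    exact Sym2.map.injective f.injective h
  · intro e he
    induction e with
    | _ x y =>
      simp only [Finset.mem_filter, SimpleGraph.mem_edgeFinset, SimpleGraph.mem_edgeSet,
        Sym2.mem_iff, not_or] at he
      obtain ⟨hxy, hx, hy⟩ := he
      have hx' : x ∈ Set.range f := by rw [hf]; exact Ne.symm hx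
      have hy' : y ∈ Set.range f := by rw [hf]; exact Ne.symm hy
      obtain ⟨x, rfl⟩ := hx'
      obtain ⟨y, rfl⟩ := hy'
      exact ⟨s(x, y), by simpa using hxy, rfl⟩
  · intro e _
    simp [Sym2.mem_map]

theorem graphState_of_embedding {H : SimpleGraph V} {G : SimpleGraph W} (f : H ↪g G) (w : W)
    (hf : Set.range f = {w}ᶜ) (a : W → Fin 2) :
    graphState G a = ((√2 : ℝ) : ℂ)⁻¹ * vertexSign G w a * graphState H (a ∘ f) := by
  have hcard : Fintype.card W = Fintype.card V + 1 := by
    have h1 := Set.ncard_add_ncard_compl {w}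
    rw [← hf, ← Set.image_univ, Set.ncard_image_of_injective _ f.injective, Set.ncard_singleton,
      Set.ncard_univ, Nat.card_eq_fintype_card, Nat.card_eq_fintype_card] at h1
    omega
  rw [graphState_eq, graphState_eq, edgeSign_of_embedding f w hf, hcard]
  ring

/-- The reduced state at `v` is maximally mixed. The value is `1` and not `1/2` because the sum also
runs over the overwritten entry `a v`. -/
theorem sum_graphState_update_mul [DecidableEq V] {G : SimpleGraph V} {u v : V} (h : G.Adj v u) (i j : Fin 2) :
    ∑ a, graphState G (Function.update a v i) * graphState G (Function.update a v j) =
      if i = j then 1 else 0 := by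
  classical
  have hne : ∑ a, graphState G (Function.update a v 0) * graphState G (Function.update a v 1) =
      0 := by
    have key : ∀ a, graphState G (Function.update a v 0) * graphState G (Function.update a v 1) =
        (2⁻¹ : ℂ) ^ Fintype.card V * ∏ w, if G.Adj v w ∧ a w = 1 then -1 else 1 := by
      intro a
      rw [graphState_eq, graphState_eq, mul_mul_mul_comm, ← mul_pow, inv_sqrt_two_mul_self,
        edgeSign_eq_mul_vertexSign G v, edgeSign_eq_mul_vertexSign G v, mul_mul_mul_comm]
      rw [awaySign_congr G v (b := a) fun w hw => Function.update_of_ne hw _ _,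
        awaySign_congr G v (a := Function.update a v 1) (b := a) fun w hw =>
          Function.update_of_ne hw _ _, awaySign_mul_self, one_mul]
      congr 1
      have h2 : vertexSign G v (Function.update a v 0) = 1 :=
        Finset.prod_eq_one fun w _ => by simp
      rw [h2, one_mul, vertexSign]
      refine Finset.prod_congr rfl fun w _ => ?_
      by_cases hw : G.Adj v w
      · simp [hw, hw.ne']
      · simp [hw]
    simp only [key]
    rw [← Finset.mul_sum]
    -- The sum over configurations factorises over the vertices, and the factor of the neighbour `u`
    -- is `1 + (-1) = 0`.
    have h3 := Fintype.prod_sum fun (w : V) (b : Fin 2) =>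
      if G.Adj v w ∧ b = 1 then (-1 : ℂ) else 1
    rw [← h3, Finset.prod_eq_zero (Finset.mem_univ u), mul_zero]
    simp [h]
  have heq : ∀ i, ∑ a, graphState G (Function.update a v i) * graphState G (Function.update a v i) =
      1 := by
    intro i
    simp [graphState_mul_self]
  fin_cases i <;> fin_cases j
  · simpa using heq 0
  · simpa using hne
  · simpa [mul_comm] using hne
  · simpa using heq 1

section Glue

variable {V : Type} [DecidableEq V]

/-- The configuration with value `i` at `v` and values `r` elsewhere. -/
def glue (v : V) (i : Fin 2) (r : {w // decide (w = v) = false} → Fin 2) (w : V) : Fin 2 :=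
  if h : w = v then i else r ⟨w, by simpa using h⟩

theorem glue_self (v : V) (i : Fin 2) (r : {w // decide (w = v) = false} → Fin 2) :
    glue v i r v = i := by
  simp [glue]

theorem update_glue (v : V) (i j : Fin 2) (r : {w // decide (w = v) = false} → Fin 2) :
    Function.update (glue v i r) v j = glue v j r := by
  funext w
  by_cases h : w = v
  · subst h; simp [glue]
  · simp [glue, h]

theorem glue_restrict (v : V) (a : V → Fin 2) : glue v (a v) (fun w => a w) = a := by
  funext w
  by_cases h : w = v
  · subst h; simp [glue]
  · simp [glue, h]

end Glue

/-- The index `decide (w = v) = false` of the rest is the form in which party `false` holds its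
qubits under `fun a => decide (a = v)`. -/
theorem sum_glue [DecidableEq V] (v : V) (g : (V → Fin 2) → ℂ) : ∑ a, g a = ∑ i, ∑ r, g (glue v i r) := by
  rw [← Fintype.sum_prod_type (f := fun p => g (glue v p.1 p.2))]
  refine Fintype.sum_equiv
    { toFun := fun a : V → Fin 2 => (a v, fun w : {w // decide (w = v) = false} => a w)
      invFun := fun p => glue v p.1 p.2
      left_inv := fun a => glue_restrict v a
      right_inv := ?_ } _ _ ?_
  · rintro ⟨i, r⟩
    refine Prod.ext (glue_self v i r) ?_
    funext ⟨w, hw⟩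
    have : w ≠ v := by simpa using hw
    simp [glue, this]
  · intro a
    simp [glue_restrict]

theorem sum_graphState_glue_mul [DecidableEq V] {G : SimpleGraph V} {u v : V} (h : G.Adj v u) (i j : Fin 2) :
    ∑ r, graphState G (glue v i r) * graphState G (glue v j r) = if i = j then 2⁻¹ else 0 := by
  have h1 := sum_graphState_update_mul h i j
  rw [sum_glue v] at h1
  simp only [update_glue, Fin.sum_univ_two] at h1
  rw [← two_mul] at h1
  have : (2 : ℂ) ≠ 0 := two_ne_zero
  apply mul_left_cancel₀ this
  rw [h1]
  split_ifs <;> simp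

end GraphStates

/-! ### From depolarised vectors to distributed noisy graph states. -/

section Conversion

variable {P V W : Type}

/-- The configuration of all qubits that belongs to given configurations of the parties. -/
def jointConfig (h : V → P) : (∀ p, {v // h v = p} → Fin 2) ≃ (V → Fin 2) where
  toFun a v := a (h v) ⟨v, rfl⟩
  invFun α _ v := α v
  left_inv a := by
    funext p ⟨v, hv⟩
    subst hv
    rfl
  right_inv _ := rfl

theorem jointConfig_apply (h : V → P) (a : ∀ p, {v // h v = p} → Fin 2) (v : V) :
    jointConfig h a v = a (h v) ⟨v, rfl⟩ := rfl

theorem jointConfig_apply_of_eq (h : V → P) (a : ∀ p, {v // h v = p} → Fin 2) {p : P} (v : V)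
    (hv : h v = p) : jointConfig h a v = a p ⟨v, hv⟩ := by
  subst hv
  rfl

variable [Fintype P] [DecidableEq P] [Fintype V] [DecidableEq V] [Fintype W] [DecidableEq W]

theorem distribute_noisyState (h : V → P) (G : SimpleGraph V) (x : ℝ) :
    distribute h (noisyState G x) =
      ((Fintype.card (∀ p, {v // h v = p} → Fin 2) : ℂ) + x)⁻¹ •
        (1 + (x : ℂ) • Matrix.vecMulVec (graphState G ∘ jointConfig h)
          (star (graphState G ∘ jointConfig h))) := by
  have hcard : (Fintype.card (∀ p, {v // h v = p} → Fin 2) : ℂ) = 2 ^ Fintype.card V := by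
    rw [Fintype.card_congr (jointConfig h)]
    simp
  have h1 : ((1 : Op fun _ : V => Fin 2).submatrix (jointConfig h) (jointConfig h)) = 1 :=
    Matrix.submatrix_one_equiv _
  rw [hcard, ← h1]
  rfl

theorem locallyConvertible_noisyState [Nonempty V] (h : V → P) (k : W → P) (H : SimpleGraph V)
    (G : SimpleGraph W) (p₀ : P)
    (A : ∀ p, Matrix ({w // k w = p} → Fin 2) ({v // h v = p} → Fin 2) ℂ)
    (hA : ∀ p, (A p)ᴴ * A p = 1) (hA' : ∀ p, p ≠ p₀ → A p * (A p)ᴴ = 1)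
    (hG : localOp A *ᵥ (graphState H ∘ jointConfig h) = graphState G ∘ jointConfig k)
    {x : ℝ} (hx : -1 ≤ x) :
    LocallyConvertible h (noisyState H x) k (noisyState G x) := by
  have hunit : star (graphState H ∘ jointConfig h) ⬝ᵥ (graphState H ∘ jointConfig h) = 1 := by
    exact ((jointConfig h).sum_comp fun a => star (graphState H a) * graphState H a).trans
      (star_graphState_dotProduct H)
  have hcard : 0 < (Fintype.card (∀ p, {v // h v = p} → Fin 2) : ℝ) + x := by
    rw [Fintype.card_congr (jointConfig h)]
    -- Having a vertex gives dimension at least 2, so the normalisation is positive even at `x =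
    -- -1`.
    have : (2 : ℝ) ^ 1 ≤ 2 ^ Fintype.card V :=
      pow_le_pow_right₀ (by norm_num) Fintype.card_pos
    simp only [Fintype.card_pi, Fintype.card_fin, Finset.prod_const, Finset.card_univ,
      Nat.cast_pow, Nat.cast_ofNat]
    linarith
  obtain ⟨Φ, hΦ, h1⟩ := exists_isSLOCC_depolarized p₀ A hA hA' _ _ hG hunit hcard
  refine ⟨Φ, hΦ, ?_⟩
  rw [distribute_noisyState, distribute_noisyState, h1]

end Conversion

/-! ### Attaching a vertex; paths and stars. -/

section Attach

variable {P V W : Type}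

/-- The part of a local configuration that lies on the smaller graph. -/
def restrictConfig (f : V → W) (k : W → P) (p : P) (a : {u // k u = p} → Fin 2) :
    {v // (k ∘ f) v = p} → Fin 2 :=
  fun v => a ⟨f v, v.2⟩

theorem restrictConfig_surjective {f : V → W} (hf : f.Injective) (k : W → P) (p : P) (w : W)
    (hw : w ∉ Set.range f) (i : Fin 2) (b : {v // (k ∘ f) v = p} → Fin 2) :
    ∃ a, restrictConfig f k p a = b ∧ ∀ h : k w = p, a ⟨w, h⟩ = i := by
  have hg : Function.Injective fun v : {v // (k ∘ f) v = p} => (⟨f v, v.2⟩ : {u // k u = p}) := by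
    intro v v' h
    exact Subtype.ext (hf (congrArg Subtype.val h))
  refine ⟨Function.extend (fun v : {v // (k ∘ f) v = p} => (⟨f v, v.2⟩ : {u // k u = p})) b
    fun _ => i, ?_, ?_⟩
  · funext v
    exact hg.extend_apply b _ v
  · intro h
    rw [Function.extend_apply']
    rintro ⟨v, hv⟩
    exact hw ⟨v, congrArg Subtype.val hv⟩

theorem restrictConfig_ext {f : V → W} (k : W → P) (p : P) (w : W)
    (hf : Set.range f = {w}ᶜ) {a a' : {u // k u = p} → Fin 2}
    (h : restrictConfig f k p a = restrictConfig f k p a')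
    (hw : ∀ h : k w = p, a ⟨w, h⟩ = a' ⟨w, h⟩) : a = a' := by
  classical
  funext ⟨u, hu⟩
  by_cases huw : u = w
  · subst huw
    exact hw hu
  · have : u ∈ Set.range f := by rw [hf]; exact huw
    obtain ⟨v, rfl⟩ := this
    exact congrFun h ⟨v, hu⟩

variable [DecidableEq P] [Fintype V] [DecidableEq V] [Fintype W]

/-- The extension of a local configuration by zero. -/
def extendConfig (k : W → P) (p : P) (a : {u // k u = p} → Fin 2) (u : W) : Fin 2 :=
  if h : k u = p then a ⟨u, h⟩ else 0

/-- The local operation that attaches the vertex `w`: its holder adds a qubit in the state `|+⟩`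
and applies controlled-phase gates to the neighbours of `w`. -/
def attachOp (f : V → W) (k : W → P) (G : SimpleGraph W) (w : W) (p : P) :
    Matrix ({u // k u = p} → Fin 2) ({v // (k ∘ f) v = p} → Fin 2) ℂ :=
  Matrix.of fun a b => if restrictConfig f k p a = b then
    (if p = k w then ((√2 : ℝ) : ℂ)⁻¹ else 1) * vertexSign G w (extendConfig k p a) else 0

/-- Over each `b` the holder of `w` has two extensions, of weight `1/2` each; any other party has
exactly one, of weight `1`. -/
theorem attachOp_conjTranspose_mul_self [DecidableEq W] {f : V → W} (hinj : f.Injective) (k : W → P)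
    (G : SimpleGraph W) (w : W) (hf : Set.range f = {w}ᶜ) (p : P) :
    (attachOp f k G w p)ᴴ * attachOp f k G w p = 1 := by
  have hw : w ∉ Set.range f := by simp [hf]
  ext b b'
  rw [Matrix.mul_apply]
  have key : ∀ a, (attachOp f k G w p)ᴴ b a * attachOp f k G w p a b' =
      (if p = k w then 2⁻¹ else 1) *
        (if restrictConfig f k p a = b then (1 : Matrix _ _ ℂ) b b' else 0) := by
    intro a
    simp only [Matrix.conjTranspose_apply, attachOp, Matrix.of_apply, Matrix.one_apply]
    by_cases h : restrictConfig f k p a = b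
    · by_cases h' : b = b'
      · subst h'
        simp only [h, if_true, mul_one]
        rw [star_mul', star_vertexSign, mul_mul_mul_comm, vertexSign_mul_self, mul_one]
        split_ifs
        · rw [← inv_sqrt_two_mul_self]
          simp
        · simp
      · simp [h, h']
    · simp [h]
  simp only [key]
  rw [← Finset.mul_sum]
  by_cases hp : p = k w
  · subst hp
    have hbij : Function.Bijective fun a : {u // k u = k w} → Fin 2 =>
        (a ⟨w, rfl⟩, restrictConfig f k (k w) a) := by
      constructor
      · intro a a' h
        exact restrictConfig_ext k _ w hf (congrArg Prod.snd h) fun _ => congrArg Prod.fst h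
      · rintro ⟨i, c⟩
        obtain ⟨a, h1, h2⟩ := restrictConfig_surjective hinj k (k w) w hw i c
        exact ⟨a, Prod.ext (h2 rfl) h1⟩
    have := hbij.sum_comp fun q => if q.2 = b then (1 : Matrix _ _ ℂ) b b' else 0
    simp only at this
    rw [this, Fintype.sum_prod_type]
    simp
  · have hbij : Function.Bijective (restrictConfig f k p) := by
      constructor
      · intro a a' h
        exact restrictConfig_ext k _ w hf h fun h => absurd h.symm hp
      · intro c
        obtain ⟨a, h1, -⟩ := restrictConfig_surjective hinj k p w hw 0 c
        exact ⟨a, h1⟩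
    rw [hbij.sum_comp fun q => if q = b then (1 : Matrix _ _ ℂ) b b' else 0]
    simp [hp]

theorem attachOp_mul_conjTranspose {f : V → W} (k : W → P)
    (G : SimpleGraph W) (w : W) (hf : Set.range f = {w}ᶜ) (p : P) (hp : p ≠ k w) :
    attachOp f k G w p * (attachOp f k G w p)ᴴ = 1 := by
  ext a a'
  simp only [Matrix.mul_apply, Matrix.conjTranspose_apply, attachOp, Matrix.of_apply, hp, if_false,
    one_mul, Matrix.one_apply]
  by_cases h : a = a'
  · subst h
    simp [star_vertexSign, vertexSign_mul_self, apply_ite star]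
  · have h' : restrictConfig f k p a ≠ restrictConfig f k p a' := fun h' =>
      h (restrictConfig_ext k _ w hf h' fun h => absurd h.symm hp)
    simp [h, h'.symm]

variable [Fintype P]

/-- The holder of `w` sees all neighbours of `w`, so its local sign is the full one. For any other
party the extension by zero puts `0` at `w`, and the sign is trivial. -/
theorem localOp_attachOp_mulVec {H : SimpleGraph V} {G : SimpleGraph W} (f : H ↪g G) (w : W)
    (hf : Set.range f = {w}ᶜ) (k : W → P) (hk : ∀ u, G.Adj w u → k u = k w) :
    localOp (attachOp f k G w) *ᵥ (graphState H ∘ jointConfig (k ∘ f)) =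
      graphState G ∘ jointConfig k := by
  classical
  funext a
  have key : ∀ b, localOp (attachOp f k G w) a b =
      if (fun p => restrictConfig f k p (a p)) = b then
        ((√2 : ℝ) : ℂ)⁻¹ * vertexSign G w (jointConfig k a) else 0 := by
    intro b
    simp only [localOp_apply, attachOp, Matrix.of_apply]
    rw [Finset.prod_ite_zero]
    simp only [Finset.mem_univ, forall_const, funext_iff (f := fun p => restrictConfig f k p (a p))]
    congr 1
    rw [Fintype.prod_eq_single (k w)]
    · rw [if_pos rfl]
      congr 1
      refine Finset.prod_congr rfl fun u _ => ?_
      by_cases hu : G.Adj w u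
      · simp [extendConfig, hk u hu, jointConfig_apply_of_eq k a u (hk u hu), jointConfig_apply]
      · simp [hu]
    · intro p hp
      rw [if_neg hp, one_mul]
      exact Finset.prod_eq_one fun u _ => by simp [extendConfig, hp.symm]
  simp only [Matrix.mulVec, dotProduct, key, ite_mul, zero_mul, Finset.sum_ite_eq, Finset.mem_univ,
    if_true, Function.comp_apply]
  rw [graphState_of_embedding f w hf]
  rfl

theorem locallyConvertible_attach [Nonempty V] [DecidableEq W] {H : SimpleGraph V} {G : SimpleGraph W}
    (f : H ↪g G) (w : W) (k : W → P) {x : ℝ} (hf : Set.range f = {w}ᶜ)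
    (hk : ∀ u, G.Adj w u → k u = k w) (hx : -1 ≤ x) :
    LocallyConvertible (k ∘ f) (noisyState H x) k (noisyState G x) :=
  locallyConvertible_noisyState _ _ _ _ (k w) (attachOp f k G w)
    (attachOp_conjTranspose_mul_self f.injective k G w hf)
    (attachOp_mul_conjTranspose k G w hf) (localOp_attachOp_mulVec f w hf k hk) hx

theorem Fin.range_castSucc_eq_compl_last (n : ℕ) :
    Set.range (Fin.castSucc : Fin n → Fin (n + 1)) = {Fin.last n}ᶜ := by
  ext i
  induction i using Fin.lastCases <;> simp

theorem locallyConvertible_pathGraph (n : ℕ) (k : Fin (n + 2) → P) {x : ℝ}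
    (hk : k (Fin.last (n + 1)) = k (Fin.last n).castSucc) (hx : -1 ≤ x) :
    LocallyConvertible (k ∘ Fin.castSucc) (noisyState (SimpleGraph.pathGraph (n + 1)) x)
      k (noisyState (SimpleGraph.pathGraph (n + 2)) x) := by
  let f : SimpleGraph.pathGraph (n + 1) ↪g SimpleGraph.pathGraph (n + 2) :=
    ⟨Fin.castSuccEmb, by simp [SimpleGraph.pathGraph_adj]⟩
  refine locallyConvertible_attach f (Fin.last (n + 1)) k (Fin.range_castSucc_eq_compl_last _) ?_ hx
  intro u hu
  rw [hk]
  congr 1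
  rw [SimpleGraph.pathGraph_adj] at hu
  ext
  simp only [Fin.val_last, Fin.val_castSucc] at hu ⊢
  omega

theorem locallyConvertible_starGraph (n : ℕ) (k : Fin (n + 2) → P) {x : ℝ}
    (hk : k (Fin.last (n + 1)) = k 0) (hx : -1 ≤ x) :
    LocallyConvertible (k ∘ Fin.castSucc) (noisyState (SimpleGraph.starGraph (0 : Fin (n + 1))) x)
      k (noisyState (SimpleGraph.starGraph (0 : Fin (n + 2))) x) := by
  let f : SimpleGraph.starGraph (0 : Fin (n + 1)) ↪g SimpleGraph.starGraph (0 : Fin (n + 2)) :=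
    ⟨Fin.castSuccEmb, by simp [SimpleGraph.starGraph_adj]⟩
  refine locallyConvertible_attach f (Fin.last (n + 1)) k (Fin.range_castSucc_eq_compl_last _) ?_ hx
  intro u hu
  rw [SimpleGraph.starGraph_adj] at hu
  obtain ⟨-, h | h⟩ := hu
  · simp [Fin.ext_iff] at h
  · rw [h, hk]

end Attach

/-! ### One vertex against the rest, from the two-qubit state. -/

section Bipartite

variable {V : Type} [Fintype V] [DecidableEq V]

/-- The local isometries that map the two-qubit graph state to the graph state of `G`, whose vertex
`v` is held by one party and whose other vertices by the other. -/
def splitOp (G : SimpleGraph V) (v : V) : ∀ p : Bool,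
    Matrix ({w // decide (w = v) = p} → Fin 2) ({b : Bool // id b = p} → Fin 2) ℂ
  | true => Matrix.of fun a b => if a ⟨v, by simp⟩ = b ⟨true, rfl⟩ then 1 else 0
  | false => Matrix.of fun r b =>
      graphState G (glue v 0 r) +
        (if b ⟨false, rfl⟩ = 1 then -1 else 1) * graphState G (glue v 1 r)

theorem graphState_top_bool (a : Bool → Fin 2) :
    graphState (⊤ : SimpleGraph Bool) a = 2⁻¹ * if a true = 1 ∧ a false = 1 then -1 else 1 := by
  rw [graphState_eq, Fintype.card_bool, sq, inv_sqrt_two_mul_self, edgeSign]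
  congr 1
  classical
  generalize hG : (⊤ : SimpleGraph Bool) = G
  have : G.edgeSet = {s(true, false)} := by
    rw [← hG]
    ext e
    induction e with
    | _ x y => cases x <;> cases y <;> simp [Sym2.eq_swap]
  rw [Finset.prod_eq_single s(true, false)]
  · simp [and_comm]
  · intro e he hne
    rw [SimpleGraph.mem_edgeFinset, this] at he
    exact absurd he hne
  · intro h
    exact absurd (SimpleGraph.mem_edgeFinset.2 (by simp [this])) h

/-- Write `ψ_G = ∑ i, |i⟩ ⊗ ψ_i` with the qubit `v` in front. The `ψ_i` are orthogonal of squared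
norm `1/2`, so `|b⟩ ↦ ψ_0 + (-1)^b ψ_1` is an isometry; it undoes the Hadamard form of `K₂`. Only
party `false` is non-unitary in general. -/
theorem locallyConvertible_bipartite (G : SimpleGraph V) {u v : V} (h : G.Adj v u) {x : ℝ}
    (hx : -1 ≤ x) :
    LocallyConvertible (id : Bool → Bool) (noisyState (⊤ : SimpleGraph Bool) x)
      (fun a => decide (a = v)) (noisyState G x) := by
  have hunique : ∀ (y : Bool) (b : {b : Bool // id b = y}), b = ⟨y, rfl⟩ := by
    rintro y ⟨b, rfl⟩
    rfl
  have hone : ∀ (y : Bool) (b b' : {b : Bool // id b = y} → Fin 2),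
      b = b' ↔ b ⟨y, rfl⟩ = b' ⟨y, rfl⟩ := by
    intro y b b'
    refine ⟨fun h => by rw [h], fun h => ?_⟩
    funext c
    rw [hunique y c, h]
  let e : ∀ y : Bool, ({b : Bool // id b = y} → Fin 2) ≃ Fin 2 := fun y =>
    { toFun := fun b => b ⟨y, rfl⟩
      invFun := fun i _ => i
      left_inv := fun b => (hone y _ _).2 rfl
      right_inv := fun _ => rfl }
  let e' : ({w // decide (w = v) = true} → Fin 2) ≃ Fin 2 :=
    { toFun := fun a => a ⟨v, by simp⟩
      invFun := fun i _ => i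
      left_inv := fun a => by
        funext ⟨w, hw⟩
        have : w = v := by simpa using hw
        subst this
        rfl
      right_inv := fun _ => rfl }
  have hO : ∀ i j, ∑ r, graphState G (glue v i r) * graphState G (glue v j r) =
    if i = j then 2⁻¹ else 0 := sum_graphState_glue_mul h
  refine locallyConvertible_noisyState _ _ _ _ false (splitOp G v) ?_ ?_ ?_ hx
  · rintro (_ | _)
    · ext b b'
      rw [Matrix.mul_apply, Matrix.one_apply]
      simp only [hone]
      simp only [Matrix.conjTranspose_apply, splitOp, Matrix.of_apply, star_add, star_mul',
        star_graphState_apply]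
      -- For signs `s`, `t` the value `(1 + s * t) / 2` is the Kronecker delta.
      have hexp : ∀ s t : ℂ, ∑ r, (graphState G (glue v 0 r) + s * graphState G (glue v 1 r)) *
          (graphState G (glue v 0 r) + t * graphState G (glue v 1 r)) = (1 + s * t) / 2 := by
        intro s t
        have : ∀ r, (graphState G (glue v 0 r) + s * graphState G (glue v 1 r)) *
          (graphState G (glue v 0 r) + t * graphState G (glue v 1 r)) =
          graphState G (glue v 0 r) * graphState G (glue v 0 r) +
          (s + t) * (graphState G (glue v 0 r) * graphState G (glue v 1 r)) +
          s * t * (graphState G (glue v 1 r) * graphState G (glue v 1 r)) := fun r => by ring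
        simp only [this, Finset.sum_add_distrib, ← Finset.mul_sum, hO]
        simp
        ring
      rw [hexp]
      generalize b ⟨false, rfl⟩ = i
      generalize b' ⟨false, rfl⟩ = j
      fin_cases i <;> fin_cases j <;> norm_num
    · ext b b'
      rw [Matrix.mul_apply, Matrix.one_apply]
      simp only [hone]
      simp only [Matrix.conjTranspose_apply, splitOp, Matrix.of_apply]
      refine (e'.sum_comp fun i => star (if i = b ⟨true, rfl⟩ then (1 : ℂ) else 0) *
        (if i = b' ⟨true, rfl⟩ then 1 else 0)).trans ?_
      simp [apply_ite star, eq_comm]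
  · rintro (_ | _) hp
    · exact absurd rfl hp
    · ext a a'
      rw [Matrix.mul_apply, Matrix.one_apply]
      simp only [← e'.injective.eq_iff (a := a)]
      simp only [Matrix.conjTranspose_apply, splitOp, Matrix.of_apply]
      refine ((e true).sum_comp fun i => (if a ⟨v, by simp⟩ = i then (1 : ℂ) else 0) *
        star (if a' ⟨v, by simp⟩ = i then (1 : ℂ) else 0)).trans ?_
      simp [apply_ite star, e', eq_comm]
  · funext a
    let E : (∀ p : Bool, {b : Bool // id b = p} → Fin 2) ≃ Fin 2 × Fin 2 :=
      { toFun := fun b => (b true ⟨true, rfl⟩, b false ⟨false, rfl⟩)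
        invFun := fun q p _ => if p then q.1 else q.2
        left_inv := fun b => by
          funext p c
          cases p <;> simp [hunique _ c]
        right_inv := fun q => by simp }
    have ha : glue v (a true ⟨v, by simp⟩) (a false) =
        jointConfig (fun a => decide (a = v)) a := by
      funext w
      by_cases hw : w = v
      · subst hw
        rw [glue_self, jointConfig_apply_of_eq (p := true) _ a w (by simp)]
      · rw [jointConfig_apply_of_eq (p := false) _ a w (by simp [hw])]
        simp [glue, hw]
    simp only [Matrix.mulVec, dotProduct, Function.comp_apply, localOp_apply, Fintype.prod_bool,
      graphState_top_bool, splitOp, Matrix.of_apply, jointConfig_apply, ← ha]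
    generalize a true ⟨v, by simp⟩ = i
    generalize a false = r
    refine (E.sum_comp fun q => (if i = q.1 then (1 : ℂ) else 0) * (graphState G (glue v 0 r) +
        (if q.2 = 1 then -1 else 1) * graphState G (glue v 1 r)) *
          (2⁻¹ * if q.1 = 1 ∧ q.2 = 1 then -1 else 1)).trans ?_
    rw [Fintype.sum_prod_type]
    fin_cases i <;> simp <;> ring

end Bipartite

open scoped ComplexOrder MatrixOrder in
theorem exists_eq_conjTranspose_mul_self {ι : Type} [Fintype ι] {A : Matrix ι ι ℂ}
    (hA : A.PosSemidef) : ∃ B : Matrix ι ι ℂ, A = Bᴴ * B := by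
  classical
  exact CStarAlgebra.nonneg_iff_eq_star_mul_self.1 hA.nonneg

/-! ### Partial transposition, and its positivity under copies and SLOCC. -/

section PartialTranspose

open scoped ComplexOrder

variable {P : Type} [DecidableEq P] {d e : P → Type}

/-- The partial transposition at the party `v`. -/
def partialTranspose (v : P) (ρ : Op d) : Op d :=
  Matrix.of fun a b => ρ (Function.update a v (b v)) (Function.update b v (a v))

theorem partialTranspose_apply (v : P) (ρ : Op d) (a b : ∀ p, d p) :
    partialTranspose v ρ a b = ρ (Function.update a v (b v)) (Function.update b v (a v)) := rfl

theorem partialTranspose_add (v : P) (ρ σ : Op d) :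
    partialTranspose v (ρ + σ) = partialTranspose v ρ + partialTranspose v σ := rfl

theorem partialTranspose_smul (v : P) (c : ℂ) (ρ : Op d) :
    partialTranspose v (c • ρ) = c • partialTranspose v ρ := rfl

theorem partialTranspose_sum {ι : Type} [Fintype ι] (v : P) (ρ : ι → Op d) :
    partialTranspose v (∑ i, ρ i) = ∑ i, partialTranspose v (ρ i) := by
  ext a b
  simp [partialTranspose_apply, Matrix.sum_apply]

theorem partialTranspose_one [Fintype P] [∀ p, DecidableEq (d p)] (v : P) :
    partialTranspose v (1 : Op d) = 1 := by
  ext a b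
  simp only [partialTranspose_apply, Matrix.one_apply]
  congr 1
  rw [eq_iff_iff]
  constructor
  · intro h
    funext p
    by_cases hp : p = v
    · subst hp
      simpa using (congrFun h p).symm
    · simpa [hp] using congrFun h p
  · rintro rfl
    rfl

/-- Party `v` holds its part of every copy, so transposing at `v` transposes all copies at once. -/
theorem partialTranspose_copies (v : P) (n : ℕ) (ρ : Op d) :
    partialTranspose v (copies n ρ) = copies n (partialTranspose v ρ) := by
  ext a b
  simp only [copies, Matrix.of_apply, partialTranspose_apply]
  refine Finset.prod_congr rfl fun k _ => ?_
  congr 1 <;>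
  · funext p
    by_cases hp : p = v
    · subst hp; simp
    · simp [hp]

variable [Fintype P]

/-- Exchanging the entries at `v` of a pair of configurations. -/
def swapAt (v : P) : ((∀ p, d p) × (∀ p, d p)) ≃ ((∀ p, d p) × (∀ p, d p)) where
  toFun q := (Function.update q.1 v (q.2 v), Function.update q.2 v (q.1 v))
  invFun q := (Function.update q.1 v (q.2 v), Function.update q.2 v (q.1 v))
  left_inv q := by simp
  right_inv q := by simp

theorem sum_swapAt [∀ p, Fintype (d p)] (v : P) (g : (∀ p, d p) → (∀ p, d p) → ℂ) :
    ∑ a, ∑ b, g (Function.update a v (b v)) (Function.update b v (a v)) = ∑ a, ∑ b, g a b := by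
  have := (swapAt (d := d) v).sum_comp fun q => g q.1 q.2
  rwa [Fintype.sum_prod_type, Fintype.sum_prod_type] at this

theorem trace_partialTranspose [∀ p, Fintype (d p)] (v : P) (ρ : Op d) :
    (partialTranspose v ρ).trace = ρ.trace := by
  simp [Matrix.trace, partialTranspose_apply]

theorem trace_partialTranspose_mul [∀ p, Fintype (d p)] (v : P) (ρ σ : Op d) :
    (partialTranspose v ρ * partialTranspose v σ).trace = (ρ * σ).trace := by
  simp only [Matrix.trace, Matrix.diag, Matrix.mul_apply, partialTranspose_apply]
  exact sum_swapAt v fun a b => ρ a b * σ b a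

/-- Transposition at `v` merely conjugates the entries of the Kraus operator of `v`; the form `K ρ
Kᴴ`, and with it positivity, survives. -/
theorem partialTranspose_localOp [∀ p, Fintype (d p)] (v : P) (K : ∀ p, Matrix (e p) (d p) ℂ)
    (ρ : Op d) :
    partialTranspose v (localOp K * ρ * (localOp K)ᴴ) =
      localOp (Function.update K v ((K v).map star)) * partialTranspose v ρ *
        (localOp (Function.update K v ((K v).map star)))ᴴ := by
  ext a b
  have expand : ∀ (L : ∀ p, Matrix (e p) (d p) ℂ) (σ : Op d) (a b : ∀ p, e p),
      (localOp L * σ * (localOp L)ᴴ) a b =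
        ∑ s, ∑ t, (∏ p, L p (a p) (s p) * star (L p (b p) (t p))) * σ s t := by
    intro L σ a b
    simp only [Matrix.mul_apply, Matrix.conjTranspose_apply, localOp_apply, Finset.sum_mul]
    rw [Finset.sum_comm]
    refine Finset.sum_congr rfl fun s _ => Finset.sum_congr rfl fun t _ => ?_
    rw [Finset.prod_mul_distrib, star_prod]
    ring
  rw [partialTranspose_apply, expand, expand]
  rw [← sum_swapAt v]
  refine Finset.sum_congr rfl fun s _ => Finset.sum_congr rfl fun t _ => ?_
  rw [partialTranspose_apply]
  congr 1
  refine Finset.prod_congr rfl fun p _ => ?_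
  by_cases hp : p = v
  · subst hp
    simp [mul_comm]
  · simp [hp]

theorem IsSLOCC.posSemidef_partialTranspose [∀ p, Fintype (d p)] [∀ p, DecidableEq (d p)]
    [∀ p, Fintype (e p)] [∀ p, DecidableEq (e p)] (v : P) {Φ : Op d → Op e} (h : IsSLOCC Φ)
    {ρ : Op d} (hρ : (partialTranspose v ρ).PosSemidef) : (partialTranspose v (Φ ρ)).PosSemidef := by
  induction h with
  | fail => exact Matrix.PosSemidef.zero
  | done => exact hρ
  | step O K hK Φ hΦ ih =>
    rw [partialTranspose_sum]
    refine Matrix.posSemidef_sum _ fun o _ => ih o ?_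
    rw [partialTranspose_localOp]
    exact hρ.mul_mul_conjTranspose_same _

theorem copies_mul [∀ p, Fintype (d p)] (n : ℕ) (ρ σ : Op d) :
    copies n (ρ * σ) = copies n ρ * copies n σ := by
  ext a b
  simp only [copies, Matrix.of_apply, Matrix.mul_apply, ← Finset.prod_mul_distrib]
  rw [Fintype.prod_sum]
  exact Fintype.sum_equiv (Equiv.piComm fun (_ : Fin n) (p : P) => d p) _ _ fun _ => rfl

theorem copies_posSemidef [∀ p, Fintype (d p)] (n : ℕ) {ρ : Op d} (hρ : ρ.PosSemidef) :
    (copies n ρ).PosSemidef := by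
  classical
  obtain ⟨B, rfl⟩ := exists_eq_conjTranspose_mul_self hρ
  have : copies n (Bᴴ * B) = (copies n B)ᴴ * copies n B := by
    rw [copies_mul]
    congr 1
    ext a b
    simp [copies]
  rw [this]
  exact Matrix.posSemidef_conjTranspose_mul_self _

end PartialTranspose

/-! ### Spectrum of the partial transpose, the threshold, and non-purifiability. -/

section Obstruction

open scoped ComplexOrder

/-- The hypotheses confine the eigenvalues of `N` to `{-1, 0, 1}`. Without diagonalising: `1 ± N =
((1 ± N)² + (1 - N²)) / 2`, where `1 - N²` is a projection, and general `s` follows by convexity. -/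
theorem posSemidef_one_add_of_pow {ι : Type} [Fintype ι] [DecidableEq ι] {N : Matrix ι ι ℂ}
    (hN : Nᴴ = N) (h : N * N * (N * N) = N * N) {s : ℝ} (hs : |s| ≤ 1) :
    (1 + (s : ℂ) • N).PosSemidef := by
  have hproj : (1 - N * N).PosSemidef := by
    have h1 := Matrix.posSemidef_conjTranspose_mul_self (1 - N * N)
    have h2 : (1 - N * N)ᴴ * (1 - N * N) = 1 - N * N := by
      rw [Matrix.conjTranspose_sub, Matrix.conjTranspose_mul, hN, Matrix.conjTranspose_one,
        sub_mul, mul_sub, mul_sub, h]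
      simp
    rwa [h2] at h1
  have hplus : ∀ t : ℝ, t * t = 1 → (1 + (t : ℂ) • N).PosSemidef := by
    intro t ht
    have ht' : (t : ℂ) * t = 1 := by exact_mod_cast ht
    have h1 := Matrix.posSemidef_conjTranspose_mul_self (1 + (t : ℂ) • N)
    have h2 : 1 + (t : ℂ) • N = (2⁻¹ : ℝ) •
        ((1 + (t : ℂ) • N)ᴴ * (1 + (t : ℂ) • N) + (1 - N * N)) := by
      rw [Matrix.conjTranspose_add, Matrix.conjTranspose_smul, hN, Matrix.conjTranspose_one]
      have : star (t : ℂ) = t := by simp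
      rw [this, add_mul, mul_add, mul_add, smul_mul_smul_comm, ht', one_smul]
      simp only [mul_one, one_mul]
      have h3 : (1 : Matrix ι ι ℂ) + (t : ℂ) • N + ((t : ℂ) • N + N * N) + (1 - N * N) =
          (2 : ℝ) • (1 + (t : ℂ) • N) := by
        rw [two_smul]
        abel
      rw [h3, smul_smul]
      norm_num
    rw [h2]
    exact (h1.add hproj).smul (by norm_num)
  have hcomb : 1 + (s : ℂ) • N = ((1 + s) / 2 : ℝ) • (1 + ((1 : ℝ) : ℂ) • N) +
      ((1 - s) / 2 : ℝ) • (1 + ((-1 : ℝ) : ℂ) • N) := by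
    ext i j
    simp
    ring
  rw [hcomb]
  obtain ⟨h1, h2⟩ := abs_le.1 hs
  exact ((hplus 1 (by norm_num)).smul (by linarith)).add
    ((hplus (-1) (by norm_num)).smul (by linarith))

variable {V : Type} [Fintype V] [DecidableEq V]

/-- Schmidt vectors of the graph state across the cut between `v` and the other vertices. -/
def schmidtOp (G : SimpleGraph V) (v : V) : Matrix (V → Fin 2) (Fin 2 × Fin 2) ℂ :=
  Matrix.of fun a q => if a v = q.1 then ((√2 : ℝ) : ℂ) * graphState G (Function.update a v q.2)
    else 0

theorem sqrt_two_mul_self : ((√2 : ℝ) : ℂ) * ((√2 : ℝ) : ℂ) = 2 := by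
  rw [← Complex.ofReal_mul, Real.mul_self_sqrt (by norm_num)]
  norm_num

/-- The factor `√2` normalises the two components of the graph state, which are orthogonal of
squared norm `1/2`. -/
theorem schmidtOp_conjTranspose_mul_self {G : SimpleGraph V} {u v : V} (h : G.Adj v u) :
    (schmidtOp G v)ᴴ * schmidtOp G v = 1 := by
  ext ⟨i, j⟩ ⟨i', j'⟩
  rw [Matrix.mul_apply, sum_glue v]
  have hs : star ((√2 : ℝ) : ℂ) = ((√2 : ℝ) : ℂ) := by simp
  have key : ∀ x r, (schmidtOp G v)ᴴ (i, j) (glue v x r) * schmidtOp G v (glue v x r) (i', j') =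
      (if x = i then if x = i' then 2 else 0 else 0) *
        (graphState G (glue v j r) * graphState G (glue v j' r)) := by
    intro x r
    simp only [Matrix.conjTranspose_apply, schmidtOp, Matrix.of_apply, glue_self, update_glue,
      apply_ite star, star_mul', star_graphState_apply, star_zero, hs]
    split_ifs
    · rw [mul_mul_mul_comm, sqrt_two_mul_self]
    all_goals simp
  simp only [key, ← Finset.mul_sum, sum_graphState_glue_mul h, Matrix.one_apply, Prod.mk.injEq]
  rw [← Finset.sum_mul]
  simp only [Finset.sum_ite_eq', Finset.mem_univ, if_true]
  by_cases h1 : i = i' <;> by_cases h2 : j = j' <;> simp [h1, h2]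

/-- The operator that exchanges two qubits. -/
def swapOp : Matrix (Fin 2 × Fin 2) (Fin 2 × Fin 2) ℂ :=
  Matrix.of fun p q => if p.swap = q then 1 else 0

/-- Across the cut, `2|ψ⟩⟨ψ| = ∑ |i⟩⟨j| ⊗ 2|ψ_i⟩⟨ψ_j|`. Transposing the first factor pairs the
Schmidt column `(j, i)` with the column `(i, j)`, which is the swap. -/
theorem two_smul_partialTranspose_eq (G : SimpleGraph V) (v : V) :
    (2 : ℂ) • partialTranspose (d := fun _ : V => Fin 2) v
      (Matrix.vecMulVec (graphState G) (star (graphState G))) =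
      schmidtOp G v * swapOp *
        (schmidtOp G v)ᴴ := by
  ext a b
  have h1 : ∀ q : Fin 2 × Fin 2, (schmidtOp G v * swapOp) a q = schmidtOp G v a q.swap := by
    intro q
    rw [Matrix.mul_apply, Finset.sum_eq_single q.swap]
    · simp [swapOp]
    · intro r _ hr
      have : r.swap ≠ q := fun h => hr (by rw [← h, Prod.swap_swap])
      simp [swapOp, this]
    · simp
  rw [Matrix.mul_apply]
  simp only [h1]
  rw [Finset.sum_eq_single (b v, a v)]
  · have hs : star ((√2 : ℝ) : ℂ) = ((√2 : ℝ) : ℂ) := by simp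
    simp only [Matrix.conjTranspose_apply, schmidtOp, Matrix.of_apply, Prod.swap, if_true,
      star_mul', hs, Matrix.smul_apply, partialTranspose_apply, Matrix.vecMulVec_apply,
      Pi.star_apply, smul_eq_mul, mul_mul_mul_comm ((√2 : ℝ) : ℂ), sqrt_two_mul_self]
  · rintro ⟨i, j⟩ _ hq
    by_cases hi : b v = i
    · by_cases hj : a v = j
      · exact absurd (by rw [hi, hj]) hq
      · simp [schmidtOp, hj]
    · simp [schmidtOp, hi]
  · simp

/-- The partially transposed projection on the graph state has spectrum in `[-1/2, 1/2]`. -/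
theorem posSemidef_one_add_partialTranspose {G : SimpleGraph V} {u v : V} (h : G.Adj v u) {x : ℝ}
    (hx : |x| ≤ 2) :
    (1 + (x : ℂ) • partialTranspose (d := fun _ : V => Fin 2) v
      (Matrix.vecMulVec (graphState G) (star (graphState G)))).PosSemidef := by
  set M := partialTranspose (d := fun _ : V => Fin 2) v
      (Matrix.vecMulVec (graphState G) (star (graphState G))) with hM
  set S := swapOp with hS
  set L := schmidtOp G v with hL
  have hN : (2 : ℂ) • M = L * S * Lᴴ := two_smul_partialTranspose_eq G v
  have hLL : Lᴴ * L = 1 := schmidtOp_conjTranspose_mul_self h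
  have hSh : Sᴴ = S := by
    ext p q
    simp [hS, swapOp, apply_ite star, Prod.ext_iff, and_comm, eq_comm]
  have hSS : S * S = 1 := by
    ext p q
    rw [Matrix.mul_apply, Finset.sum_eq_single p.swap]
    · simp [hS, swapOp, Matrix.one_apply]
    · intro r _ hr
      simp [hS, swapOp, hr.symm]
    · simp
  have hNh : (L * S * Lᴴ)ᴴ = L * S * Lᴴ := by
    rw [Matrix.conjTranspose_mul, Matrix.conjTranspose_mul, hSh, Matrix.conjTranspose_conjTranspose,
      Matrix.mul_assoc]
  -- The square is the projection onto the range of `L`, since the swap is an involution.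
  have hNN : L * S * Lᴴ * (L * S * Lᴴ) = L * Lᴴ := by
    calc L * S * Lᴴ * (L * S * Lᴴ) = L * (S * (Lᴴ * L) * S) * Lᴴ := by
          simp only [Matrix.mul_assoc]
      _ = L * Lᴴ := by rw [hLL, Matrix.mul_one, hSS, Matrix.mul_one]
  have hP : L * Lᴴ * (L * Lᴴ) = L * Lᴴ := by
    rw [Matrix.mul_assoc, ← Matrix.mul_assoc Lᴴ, hLL, Matrix.one_mul]
  have := posSemidef_one_add_of_pow hNh (by rw [hNN, hP]) (s := x / 2)
    (by rw [abs_div, abs_two]; linarith)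
  rw [← hN, smul_smul] at this
  convert this using 3
  push_cast
  ring

theorem fidelity_eq_trace {ι : Type} [Fintype ι] (ψ : ι → ℂ) (ρ : Matrix ι ι ℂ) :
    fidelity ψ ρ = (ρ * Matrix.vecMulVec ψ (star ψ)).trace.re := by
  rw [fidelity, Matrix.mul_vecMulVec, Matrix.trace_vecMulVec, dotProduct_comm]

/-- A state with positive partial transpose at `v` has overlap at most `1/2` with the graph state. -/
theorem fidelity_le_of_posSemidef_partialTranspose {G : SimpleGraph V} {u v : V} (h : G.Adj v u)
    {σ : Op fun _ : V => Fin 2} (hσ : (partialTranspose v σ).PosSemidef) :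
    fidelity (graphState G) σ ≤ σ.trace.re / 2 := by
  -- At the extreme value `-2`, pairing with `σ` gives `tr σ - 2⟨ψ|σ|ψ⟩`, as transposing both
  -- factors preserves the trace of a product.
  have h1 := posSemidef_one_add_partialTranspose h (x := -2) (by norm_num)
  have h2 : 0 ≤ (partialTranspose v σ * (1 + ((-2 : ℝ) : ℂ) •
      partialTranspose (d := fun _ : V => Fin 2) v
        (Matrix.vecMulVec (graphState G) (star (graphState G))))).trace := by
    obtain ⟨B, hB⟩ := exists_eq_conjTranspose_mul_self hσ
    rw [hB, Matrix.mul_assoc, Matrix.trace_mul_comm]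
    exact (h1.mul_mul_conjTranspose_same B).trace_nonneg
  rw [mul_add, mul_one, Matrix.mul_smul, Matrix.trace_add, Matrix.trace_smul,
    trace_partialTranspose, trace_partialTranspose_mul] at h2
  have h3 := (Complex.le_def.1 h2).1
  rw [fidelity_eq_trace]
  simp at h3
  linarith

theorem noisyState_posSemidef_partialTranspose {G : SimpleGraph V} {u v : V} (h : G.Adj v u) {x : ℝ}
    (hx : -1 ≤ x) (hx2 : x ≤ 2) : (partialTranspose v (noisyState G x)).PosSemidef := by
  rw [noisyState, partialTranspose_smul, partialTranspose_add, partialTranspose_one,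
    partialTranspose_smul]
  have h1 := posSemidef_one_add_partialTranspose h (x := x) (abs_le.2 ⟨by linarith, hx2⟩)
  have hpos : (0 : ℝ) ≤ (2 ^ Fintype.card V + x)⁻¹ := by
    have : (1 : ℝ) ≤ 2 ^ Fintype.card V := one_le_pow₀ (by norm_num)
    exact inv_nonneg.2 (by linarith)
  have := h1.smul (a := (((2 ^ Fintype.card V + x)⁻¹ : ℝ) : ℂ)) (by exact_mod_cast hpos)
  simpa using this

theorem not_purifiable_noisyState {G : SimpleGraph V} {u v : V} (h : G.Adj v u) {x : ℝ}
    (hx : -1 ≤ x) (hx2 : x ≤ 2) : ¬ Purifiable (noisyState G x) (graphState G) := by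
  intro hpur
  -- Any `ε < 1/2` would do, the attainable fidelity being at most `1/2`.
  obtain ⟨n, Φ, hΦ, hpos, hfid⟩ := hpur (1 / 4) (by norm_num)
  have h1 : (partialTranspose v (copies n (noisyState G x))).PosSemidef := by
    rw [partialTranspose_copies]
    exact copies_posSemidef n (noisyState_posSemidef_partialTranspose h hx hx2)
  have h2 := fidelity_le_of_posSemidef_partialTranspose h (hΦ.posSemidef_partialTranspose v h1)
  rw [le_div_iff₀ hpos] at hfid
  linarith

theorem fidelity_noisyState (G : SimpleGraph V) (x : ℝ) :
    fidelity (graphState G) (noisyState G x) = (1 + x) / (2 ^ Fintype.card V + x) := by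
  have h : star (graphState G) ⬝ᵥ (noisyState G x *ᵥ graphState G) =
      (((1 + x) / (2 ^ Fintype.card V + x) : ℝ) : ℂ) := by
    rw [noisyState, Matrix.smul_mulVec, Matrix.add_mulVec, Matrix.one_mulVec, Matrix.smul_mulVec,
      Matrix.vecMulVec_mulVec, star_graphState_dotProduct, dotProduct_smul, dotProduct_add,
      star_graphState_dotProduct, dotProduct_smul]
    simp [star_graphState_dotProduct]
    ring
  rw [fidelity, h, Complex.ofReal_re]

theorem fidelity_noisyState_le_iff {G : SimpleGraph V} (hG : G ≠ ⊥) {x : ℝ} (hx : -1 ≤ x) :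
    fidelity (graphState G) (noisyState G x) ≤ 3 / (2 ^ Fintype.card V + 2) ↔ x ≤ 2 := by
  have hV : Nonempty V := by
    obtain ⟨u, -⟩ := SimpleGraph.ne_bot_iff_exists_adj.1 hG
    exact ⟨u⟩
  have h2 : (2 : ℝ) ^ 1 ≤ 2 ^ Fintype.card V := pow_le_pow_right₀ (by norm_num) Fintype.card_pos
  rw [fidelity_noisyState, div_le_div_iff₀ (by linarith) (by linarith)]
  generalize (2 : ℝ) ^ Fintype.card V = D at h2
  -- After cross-multiplication the two sides differ by `(D - 1) * (x - 2)`, and `D ≥ 2`.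
  have : (1 + x) * (D + 2) ≤ 3 * (D + x) ↔ (D - 1) * x ≤ (D - 1) * 2 := by
    constructor <;> intro h <;> linarith
  rw [this, mul_le_mul_iff_right₀ (by linarith)]

end Obstruction

end

theorem mainTheorem4 :
    -- Attaching a new vertex `w` whose neighbours are all held by the holder of `w`:
    -- the `N`-qubit noisy state is built locally from the `(N-1)`-qubit one, with the same `x`.
    (∀ (P V W : Type) [Fintype P] [DecidableEq P] [Fintype V] [DecidableEq V] [Nonempty V]
        [Fintype W] [DecidableEq W] (H : SimpleGraph V) (G : SimpleGraph W) (f : H ↪g G) (w : W)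
        (k : W → P) (x : ℝ), Set.range f = {w}ᶜ → (∀ u, G.Adj w u → k u = k w) → -1 ≤ x →
        LocallyConvertible (k ∘ f) (noisyState H x) k (noisyState G x)) ∧
    -- Linear clusters: the new end of the chain is held by the holder of the previous end.
    (∀ (P : Type) [Fintype P] [DecidableEq P] (n : ℕ) (k : Fin (n + 2) → P) (x : ℝ),
        k (Fin.last (n + 1)) = k (Fin.last n).castSucc → -1 ≤ x →
        LocallyConvertible (k ∘ Fin.castSucc) (noisyState (SimpleGraph.pathGraph (n + 1)) x)
          k (noisyState (SimpleGraph.pathGraph (n + 2)) x)) ∧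
    -- GHZ states (graph states of stars): the new leaf is held by the holder of the centre.
    (∀ (P : Type) [Fintype P] [DecidableEq P] (n : ℕ) (k : Fin (n + 2) → P) (x : ℝ),
        k (Fin.last (n + 1)) = k 0 → -1 ≤ x →
        LocallyConvertible (k ∘ Fin.castSucc) (noisyState (SimpleGraph.starGraph (0 : Fin (n + 1))) x)
          k (noisyState (SimpleGraph.starGraph (0 : Fin (n + 2))) x)) ∧
    -- All graphs: if one party holds a single non-isolated vertex `v` and the other party holds
    -- the rest, the noisy state is built locally from the two-qubit one, with the same `x`.
    (∀ (V : Type) [Fintype V] [DecidableEq V] (G : SimpleGraph V) (u v : V) (x : ℝ),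
        G.Adj v u → -1 ≤ x →
        LocallyConvertible (id : Bool → Bool) (noisyState (⊤ : SimpleGraph Bool) x)
          (fun a => decide (a = v)) (noisyState G x)) ∧
    -- Fidelity, the threshold `x = 2`, and impossibility of purification for every graph with an
    -- edge, every qubit being held by a different party.
    (∀ (V : Type) [Fintype V] [DecidableEq V] (G : SimpleGraph V) (x : ℝ), G ≠ ⊥ → -1 ≤ x →
        fidelity (graphState G) (noisyState G x) = (1 + x) / (2 ^ Fintype.card V + x) ∧
        (fidelity (graphState G) (noisyState G x) ≤ 3 / (2 ^ Fintype.card V + 2) ↔ x ≤ 2) ∧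
        (fidelity (graphState G) (noisyState G x) ≤ 3 / (2 ^ Fintype.card V + 2) →
          ¬ Purifiable (noisyState G x) (graphState G))) := by
  refine ⟨?_, ?_, ?_, ?_, ?_⟩
  · intro P V W _ _ _ _ _ _ _ H G f w k x hf hk hx
    exact locallyConvertible_attach f w k hf hk hx
  · intro P _ _ n k x hk hx
    exact locallyConvertible_pathGraph n k hk hx
  · intro P _ _ n k x hk hx
    exact locallyConvertible_starGraph n k hk hx
  · intro V _ _ G u v x h hx
    exact locallyConvertible_bipartite G h hx
  · intro V _ _ G x hG hx
    obtain ⟨v, u, h⟩ := SimpleGraph.ne_bot_iff_exists_adj.1 hG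
    exact ⟨fidelity_noisyState G x, fidelity_noisyState_le_iff hG hx, fun hF =>
      not_purifiable_noisyState h hx ((fidelity_noisyState_le_iff hG hx).1 hF)⟩
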